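/- Let $K$ be an infinite field and let $n\ge 1$, $r$ be natural numbers. Let the extended affine Weyl group $\widehat\Sigma_r=\Sigma_r\ltimes\mathbb Z^r$ act on the right on $I(\mathbb Z,r)=\mathbb Z^r$, the set of $r$-tuples of integers, with $\Sigma_r$ acting by place permutation and $\varepsilon\in\mathbb Z^r$ acting by $\underline i\mapsto \underline i+n\varepsilon$; let it act diagonally on $I(\mathbb Z,r)\times I(\mathbb Z,r)$, and write $\sim$ for "lies in the same orbit as". The affine Schur algebra $\widetilde S(n,r)$ is the $K$-algebra with one basis element $\xi_{\underline i,\underline j}$ for each orbit (so $\xi_{\underline i,\underline j}=\xi_{\underline k,\underline l}$ if and only if $(\underline i,\underline j)\sim(\underline k,\underline l)$) and with multiplication $$\xi_{\underline i,\underline j}\,\xi_{\underline k,\underline l}=\sum_{(\underline p,\underline q)}\#\{\underline s\in I(\mathbb Z,r) : (\underline i,\underline j)\sim(\underline p,\underline s),\ (\underline s,\underline q)\sim(\underline k,\underline l)\}\;\xi_{\underline p,\underline q},$$ where $(\underline p,\underline q)$ runs over representatives of the orbits. Let $I(n,r)\subset I(\mathbb Z,r)$ be the set of tuples with entries in $\{1,\dots,n\}$.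 For $\underline i\in I(n,r)$ the element $\xi_{\underline i,\underline i}$ is an idempotent; let $\widetilde S(\underline i)=\xi_{\underline i,\underline i}\,\widetilde S(n,r)\,\xi_{\underline i,\underline i}$, a ring with identity $\xi_{\underline i,\underline i}$. Then: (i) for every $\underline i\in I(n,r)$, the ring $\widetilde S(\underline i)$ is Noetherian (left and right); (ii) the ring $\widetilde S(n,r)$ is Noetherian (left and right). -/

import Mathlib

noncomputable section

namespace AffineSchur

/-- `I(ℤ, r)`: the `r`-tuples of integers. -/
abbrev Tuple (r : ℕ) : Type := Fin r → ℤ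

/-- `I(n, r)`: the `r`-tuples with entries in `{1, …, n}`. -/
def tuples (n r : ℕ) : Set (Tuple r) := {i | ∀ t, 1 ≤ i t ∧ i t ≤ n}

/-- The right action on `I(ℤ, r)` of the element `σ ε` of the extended affine Weyl group
`Σ_r ⋉ ℤ^r`: place permutation by `σ`, followed by the shift by `n ε`. -/
def act (n : ℕ) {r : ℕ} (i : Tuple r) (σ : Equiv.Perm (Fin r)) (ε : Fin r → ℤ) : Tuple r :=
  fun t => i (σ t) + n * ε t

/-- The orbit equivalence relation of the diagonal action of the extended affine Weyl group on
`I(ℤ, r) × I(ℤ, r)`. -/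
def orbitSetoid (n r : ℕ) : Setoid (Tuple r × Tuple r) where
  r x y := ∃ (σ : Equiv.Perm (Fin r)) (ε : Fin r → ℤ),
    y.1 = act n x.1 σ ε ∧ y.2 = act n x.2 σ ε
  iseqv := by
    refine ⟨fun x => ⟨1, 0, ?_, ?_⟩, ?_, ?_⟩
    · funext t; simp [act]
    · funext t; simp [act]
    · rintro x y ⟨σ, ε, h1, h2⟩
      refine ⟨σ⁻¹, fun t => - ε (σ⁻¹ t), ?_, ?_⟩
      · funext t; simp [act, h1]
      · funext t; simp [act, h2]
    · rintro x y z ⟨σ, ε, h1, h2⟩ ⟨τ, η, h3, h4⟩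
      refine ⟨σ * τ, fun t => ε (τ t) + η t, ?_, ?_⟩
      · funext t; simp [act, h1, h3]; ring
      · funext t; simp [act, h2, h4]; ring

/-- The set of orbits of the extended affine Weyl group on `I(ℤ, r) × I(ℤ, r)`. -/
abbrev Orbit (n r : ℕ) : Type := Quotient (orbitSetoid n r)

/-- The orbit of the pair `(i, j)`. -/
def orbit (n : ℕ) {r : ℕ} (i j : Tuple r) : Orbit n r := Quotient.mk (orbitSetoid n r) (i, j)

theorem orbit_eq_iff {n r : ℕ} {i j k l : Tuple r} :
    orbit n i j = orbit n k l ↔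
      ∃ (σ : Equiv.Perm (Fin r)) (ε : Fin r → ℤ), k = act n i σ ε ∧ l = act n j σ ε :=
  Quotient.eq (r := orbitSetoid n r)

theorem act_injective (n : ℕ) {r : ℕ} (σ : Equiv.Perm (Fin r)) (ε : Fin r → ℤ) :
    Function.Injective fun i : Tuple r => act n i σ ε := by
  intro i j h
  funext t
  have := congrFun h (σ⁻¹ t)
  simpa [act] using this

theorem orbit_act (n : ℕ) {r : ℕ} (i j : Tuple r) (σ : Equiv.Perm (Fin r)) (ε : Fin r → ℤ) :
    orbit n (act n i σ ε) (act n j σ ε) = orbit n i j :=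
  (orbit_eq_iff.2 ⟨σ, ε, rfl, rfl⟩).symm

theorem act_surjective (n : ℕ) {r : ℕ} (σ : Equiv.Perm (Fin r)) (ε : Fin r → ℤ) :
    Function.Surjective fun i : Tuple r => act n i σ ε := by
  intro i
  refine ⟨fun t => i (σ⁻¹ t) - n * ε (σ⁻¹ t), ?_⟩
  funext t
  simp [act]

theorem finite_right {n r : ℕ} (p : Tuple r) (a : Orbit n r) :
    {s : Tuple r | orbit n p s = a}.Finite := by
  rcases Set.eq_empty_or_nonempty {s : Tuple r | orbit n p s = a} with h | ⟨s₀, h₀⟩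
  · rw [h]; exact Set.finite_empty
  · refine (Set.finite_range
      fun σ : Equiv.Perm (Fin r) => fun t => s₀ (σ t) + (p t - p (σ t))).subset ?_
    intro s hs
    obtain ⟨σ, ε, h1, h2⟩ := orbit_eq_iff.1 (Eq.trans h₀ (Eq.symm hs))
    refine ⟨σ, funext fun t => ?_⟩
    have e1 := congrFun h1 t
    have e2 := congrFun h2 t
    simp only [act] at e1 e2 ⊢
    linarith

theorem orbit_swap {n r : ℕ} {i j k l : Tuple r} (h : orbit n i j = orbit n k l) :
    orbit n j i = orbit n l k := by
  obtain ⟨σ, ε, h1, h2⟩ := orbit_eq_iff.1 h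
  exact orbit_eq_iff.2 ⟨σ, ε, h2, h1⟩

theorem finite_left {n r : ℕ} (q : Tuple r) (a : Orbit n r) :
    {s : Tuple r | orbit n s q = a}.Finite := by
  rcases Set.eq_empty_or_nonempty {s : Tuple r | orbit n s q = a} with h | ⟨s₀, h₀⟩
  · rw [h]; exact Set.finite_empty
  · refine (finite_right q (orbit n q s₀)).subset ?_
    intro s hs
    exact orbit_swap (Eq.trans hs (Eq.symm h₀))

/-- The structure constant `Z(i, j, k, l, p, q)`: the number of `s ∈ I(ℤ, r)` with
`(i, j) ∼ (p, s)` and `(s, q) ∼ (k, l)`, where `a`, `b`, `c` are the orbits of `(i, j)`,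
`(k, l)`, `(p, q)`. -/
def structureConst {n r : ℕ} (a b c : Orbit n r) : ℕ :=
  Quotient.lift (s := orbitSetoid n r)
    (fun x => Set.ncard {s : Tuple r | a = orbit n x.1 s ∧ orbit n s x.2 = b})
    (by
      rintro ⟨p, q⟩ ⟨p', q'⟩ ⟨σ, ε, h1, h2⟩
      simp only at h1 h2
      subst h1 h2
      refine Set.ncard_congr (fun s _ => act n s σ ε) ?_ ?_ ?_
      · rintro s ⟨hs1, hs2⟩
        exact ⟨by rw [orbit_act]; exact hs1, by rw [orbit_act]; exact hs2⟩
      · intro s t _ _ h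
        exact act_injective n σ ε h
      · rintro t ⟨ht1, ht2⟩
        obtain ⟨s, rfl⟩ := act_surjective n σ ε t
        simp only [orbit_act] at ht1 ht2
        exact ⟨s, ⟨ht1, ht2⟩, rfl⟩)
    c

theorem structureConst_orbit {n r : ℕ} (a b : Orbit n r) (p q : Tuple r) :
    structureConst a b (orbit n p q) =
      Set.ncard {s : Tuple r | a = orbit n p s ∧ orbit n s q = b} := rfl

theorem finite_structureConst {n r : ℕ} (a b : Orbit n r) :
    {c : Orbit n r | structureConst a b c ≠ 0}.Finite := by
  obtain ⟨⟨i, j⟩, rfl⟩ := Quotient.exists_rep a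
  change {c : Orbit n r | structureConst (orbit n i j) b c ≠ 0}.Finite
  refine (((finite_right i (orbit n i j)).biUnion
    fun s _ => finite_right s b).image fun q => orbit n i q).subset ?_
  intro c hc
  obtain ⟨⟨p, q⟩, rfl⟩ := Quotient.exists_rep c
  obtain ⟨s, hs1, hs2⟩ := Set.nonempty_of_ncard_ne_zero hc
  simp only at hs1 hs2
  obtain ⟨σ, ε, h1, h2⟩ := orbit_eq_iff.1 hs1.symm
  refine ⟨act n q σ ε, ?_, ?_⟩
  · simp only [Set.mem_iUnion]
    refine ⟨j, rfl, ?_⟩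
    change orbit n j (act n q σ ε) = b
    rw [h2, orbit_act, hs2]
  · change orbit n i (act n q σ ε) = orbit n p q
    rw [h1, orbit_act]

end AffineSchur

/-- The affine Schur algebra `S̃(n, r)` over `K`: the free `K`-module on the orbits of the extended
affine Weyl group on `I(ℤ, r) × I(ℤ, r)`. Its multiplication is defined below. -/
def AffineSchurAlgebra (K : Type*) [CommRing K] (n r : ℕ) : Type _ :=
  AffineSchur.Orbit n r →₀ K

namespace AffineSchur

variable {K : Type*} [CommRing K] {n r : ℕ}

instance : AddCommGroup (AffineSchurAlgebra K n r) :=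
  inferInstanceAs (AddCommGroup (Orbit n r →₀ K))

instance : Module K (AffineSchurAlgebra K n r) :=
  inferInstanceAs (Module K (Orbit n r →₀ K))

/-- The basis element attached to an orbit. -/
def basisElt (K : Type*) [CommRing K] {n r : ℕ} (c : Orbit n r) : AffineSchurAlgebra K n r :=
  (Finsupp.single c 1 : Orbit n r →₀ K)

/-- The basis element `ξ_{i,j}`. -/
def xi (K : Type*) [CommRing K] (n : ℕ) {r : ℕ} (i j : Tuple r) : AffineSchurAlgebra K n r :=
  basisElt K (orbit n i j)

/-- The coefficient of an element at an orbit. -/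
def coeff (f : AffineSchurAlgebra K n r) (c : Orbit n r) : K :=
  (show Orbit n r →₀ K from f) c

/-- The product of two basis elements: `∑_c Z(a, b, c) ξ_c`. -/
def basisMul (K : Type*) [CommRing K] {n r : ℕ} (a b : Orbit n r) : AffineSchurAlgebra K n r :=
  ∑ c ∈ (finite_structureConst a b).toFinset, (structureConst a b c : K) • basisElt K c

/-- The multiplication: the bilinear extension of the product of basis elements. -/
instance : Mul (AffineSchurAlgebra K n r) where
  mul f g := Finsupp.sum (show Orbit n r →₀ K from f) fun a x =>
    Finsupp.sum (show Orbit n r →₀ K from g) fun b y => (x * y) • basisMul K a b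

/-- The identity element: the sum of the `ξ_{i,i}` over representatives `i` of
`I(n, r) / Σ_r`, that is, over the orbits of the pairs `(i, i)` with `i ∈ I(n, r)`. -/
instance : One (AffineSchurAlgebra K n r) where
  one := by
    classical
    exact ∑ c ∈ Finset.univ.image
      (fun i : Fin r → Fin n => orbit n (fun t => (i t : ℤ) + 1) (fun t => (i t : ℤ) + 1)),
      basisElt K c

@[ext]
theorem ext {f g : AffineSchurAlgebra K n r}
    (h : ∀ p q, coeff f (orbit n p q) = coeff g (orbit n p q)) : f = g := by
  refine Finsupp.ext (α := Orbit n r) (M := K) fun c => ?_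
  obtain ⟨⟨p, q⟩, rfl⟩ := Quotient.exists_rep c
  exact h p q

/-- The coefficient at an orbit, as a linear map. -/
def coeffL (K : Type*) [CommRing K] {n r : ℕ} (c : Orbit n r) :
    AffineSchurAlgebra K n r →ₗ[K] K :=
  Finsupp.lapply (M := K) (R := K) c

theorem coeff_eq (f : AffineSchurAlgebra K n r) (c : Orbit n r) : coeff f c = coeffL K c f := rfl

open Classical in
theorem coeff_basisElt (a c : Orbit n r) :
    coeff (basisElt K a) c = if a = c then 1 else 0 :=
  Finsupp.single_apply

theorem coeff_basisMul (a b c : Orbit n r) :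
    coeff (basisMul K a b) c = (structureConst a b c : K) := by
  classical
  rw [coeff_eq, basisMul, map_sum]
  simp only [map_smul, ← coeff_eq, coeff_basisElt, smul_eq_mul]
  by_cases h : structureConst a b c = 0
  · rw [h]
    refine (Finset.sum_eq_zero fun d _ => ?_).trans Nat.cast_zero.symm
    split_ifs with hd
    · subst hd; simp [h]
    · simp
  · rw [Finset.sum_eq_single c]
    · simp
    · intro d _ hd; simp [hd]
    · intro hc; exact absurd ((finite_structureConst a b).mem_toFinset.2 h) hc

theorem mul_def (f g : AffineSchurAlgebra K n r) :
    f * g = Finsupp.sum (show Orbit n r →₀ K from f) fun a x =>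
      Finsupp.sum (show Orbit n r →₀ K from g) fun b y => (x * y) • basisMul K a b := rfl

/-- The column `q` of the matrix `(p, q) ↦ coeff f (orbit n p q)`. -/
def col (f : AffineSchurAlgebra K n r) (q : Tuple r) : Tuple r →₀ K :=
  Finsupp.ofSupportFinite (fun s => coeff f (orbit n s q)) (by
    classical
    refine ((Finset.finite_toSet (Finsupp.support (show Orbit n r →₀ K from f))).biUnion
      fun a _ => finite_left q a).subset ?_
    intro s hs
    simp only [Set.mem_iUnion]
    exact ⟨orbit n s q, Finsupp.mem_support_iff.2 hs, rfl⟩)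

theorem col_apply (f : AffineSchurAlgebra K n r) (p q : Tuple r) :
    col f q p = coeff f (orbit n p q) := rfl

/-- The action of an element of the affine Schur algebra on the free module on `I(ℤ, r)`. -/
def toEnd (f : AffineSchurAlgebra K n r) : Module.End K (Tuple r →₀ K) :=
  Finsupp.linearCombination K (col f)

theorem toEnd_single (f : AffineSchurAlgebra K n r) (p q : Tuple r) :
    toEnd f (Finsupp.single q 1) p = coeff f (orbit n p q) := by
  simp [toEnd, col_apply]

theorem toEnd_injective :
    Function.Injective (toEnd : AffineSchurAlgebra K n r → Module.End K (Tuple r →₀ K)) := by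
  intro f g h
  ext p q
  rw [← toEnd_single, ← toEnd_single, h]

theorem toEnd_ext {φ : Module.End K (Tuple r →₀ K)} {f : AffineSchurAlgebra K n r}
    (h : ∀ p q, φ (Finsupp.single q 1) p = coeff f (orbit n p q)) : toEnd f = φ := by
  refine Finsupp.lhom_ext' fun q => LinearMap.ext_ring ?_
  ext p
  simpa [toEnd_single] using (h p q).symm

theorem toEnd_zero : toEnd (0 : AffineSchurAlgebra K n r) = 0 := toEnd_ext fun _ _ => rfl

theorem toEnd_add (f g : AffineSchurAlgebra K n r) : toEnd (f + g) = toEnd f + toEnd g :=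
  toEnd_ext fun p q => by
    rw [LinearMap.add_apply, Finsupp.add_apply, toEnd_single, toEnd_single]; rfl

theorem toEnd_smul (x : K) (f : AffineSchurAlgebra K n r) : toEnd (x • f) = x • toEnd f :=
  toEnd_ext fun p q => by
    rw [LinearMap.smul_apply, Finsupp.smul_apply, toEnd_single]; rfl

/-- `toEnd` as a linear map. -/
def toEndL (K : Type*) [CommRing K] (n r : ℕ) :
    AffineSchurAlgebra K n r →ₗ[K] Module.End K (Tuple r →₀ K) where
  toFun := toEnd
  map_add' := toEnd_add
  map_smul' := toEnd_smul

theorem toEnd_basisMul (a b : Orbit n r) :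
    toEnd (basisMul K a b) = toEnd (basisElt K a) * toEnd (basisElt K b) := by
  classical
  refine toEnd_ext fun p q => ?_
  obtain ⟨⟨p', q'⟩, h⟩ := Quotient.exists_rep (orbit n p q)
  rw [coeff_basisMul, structureConst_orbit, Module.End.mul_apply]
  have h1 : toEnd (basisElt K b) (Finsupp.single q 1) = col (basisElt K b) q := by
    simp [toEnd]
  rw [h1, toEnd, Finsupp.linearCombination_apply, Finsupp.sum_apply,
    Finsupp.sum_of_support_subset (s := (finite_left q b).toFinset)]
  · simp only [Finsupp.smul_apply, col_apply, coeff_basisElt, smul_eq_mul, mul_ite, mul_one,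
      mul_zero]
    have : {s : Tuple r | a = orbit n p s ∧ orbit n s q = b} =
        (((finite_left q b).toFinset.filter fun s => a = orbit n p s : Finset (Tuple r)) :
          Set (Tuple r)) := by
      ext s
      simp [and_comm]
    rw [this, Set.ncard_coe_finset, ← Finset.sum_boole]
    refine Finset.sum_congr rfl fun s hs => ?_
    have hs : orbit n s q = b := by simpa using hs
    simp [hs]
  · intro s hs
    rw [Finsupp.mem_support_iff, col_apply, coeff_basisElt] at hs
    simp only [Set.Finite.mem_toFinset, Set.mem_ofPred_eq]
    by_contra h
    exact hs (if_neg fun h' => h h'.symm)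
  · intro s _; simp

theorem sum_basisElt (f : AffineSchurAlgebra K n r) :
    f = Finsupp.sum (show Orbit n r →₀ K from f) fun a x => x • basisElt K a := by
  refine (Finsupp.sum_single (show Orbit n r →₀ K from f)).symm.trans ?_
  refine Finset.sum_congr rfl fun a _ => ?_
  exact (Finsupp.smul_single_one a _).symm

theorem toEnd_mul (f g : AffineSchurAlgebra K n r) : toEnd (f * g) = toEnd f * toEnd g := by
  have key : ∀ f : AffineSchurAlgebra K n r, toEnd f =
      Finsupp.sum (show Orbit n r →₀ K from f) fun a x => x • toEnd (basisElt K a) := by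
    intro f
    conv_lhs => rw [sum_basisElt f]
    change toEndL K n r _ = _
    rw [Finsupp.sum, map_sum]
    refine Finset.sum_congr rfl fun a _ => ?_
    exact toEnd_smul _ _
  rw [key f, key g, mul_def]
  change toEndL K n r _ = _
  simp only [Finsupp.sum, map_sum, Finset.sum_mul, Finset.mul_sum]
  rw [Finset.sum_comm]
  refine Finset.sum_congr rfl fun b _ => Finset.sum_congr rfl fun a _ => ?_
  refine (toEnd_smul _ _).trans ?_
  rw [toEnd_basisMul, smul_mul_smul_comm]

theorem diag_orbit {i p q : Tuple r} : orbit n i i = orbit n p q → p = q := by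
  intro h
  obtain ⟨σ, ε, h1, h2⟩ := orbit_eq_iff.1 h
  rw [h1, h2]

theorem toEnd_one [NeZero n] : toEnd (1 : AffineSchurAlgebra K n r) = 1 := by
  classical
  refine toEnd_ext fun p q => ?_
  change (Finsupp.single q (1 : K)) p = coeffL K _ (∑ c ∈ _, basisElt K c)
  rw [map_sum]
  simp only [← coeff_eq, coeff_basisElt, Finset.sum_ite_eq', Finsupp.single_apply]
  refine if_congr ?_ rfl rfl
  simp only [Finset.mem_image, Finset.mem_univ, true_and]
  constructor
  · rintro rfl
    have hn : (0 : ℤ) < n := by exact_mod_cast NeZero.pos n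
    refine ⟨fun t => ⟨((q t - 1) % n).toNat, ?_⟩, orbit_eq_iff.2
      ⟨1, fun t => (q t - 1) / n, ?_, ?_⟩⟩
    · have := Int.emod_lt_of_pos (q t - 1) hn
      have := Int.emod_nonneg (q t - 1) hn.ne'
      omega
    all_goals
      funext t
      have h1 := Int.emod_nonneg (q t - 1) hn.ne'
      have h2 := Int.emod_add_mul_ediv (q t - 1) n
      simp only [act, Equiv.Perm.coe_one, id, Int.toNat_of_nonneg h1]
      linarith
  · rintro ⟨i, hi⟩
    exact (diag_orbit hi).symm

/-- The ring structure of the affine Schur algebra. -/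
instance [NeZero n] : Ring (AffineSchurAlgebra K n r) :=
  { (inferInstance : AddCommGroup (AffineSchurAlgebra K n r)),
    (inferInstance : Mul (AffineSchurAlgebra K n r)),
    (inferInstance : One (AffineSchurAlgebra K n r)) with
    left_distrib := fun f g h => toEnd_injective (by simp only [toEnd_mul, toEnd_add, mul_add])
    right_distrib := fun f g h => toEnd_injective (by simp only [toEnd_mul, toEnd_add, add_mul])
    zero_mul := fun f => toEnd_injective (by simp only [toEnd_mul, toEnd_zero, zero_mul])
    mul_zero := fun f => toEnd_injective (by simp only [toEnd_mul, toEnd_zero, mul_zero])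
    mul_assoc := fun f g h => toEnd_injective (by simp only [toEnd_mul, mul_assoc])
    one_mul := fun f => toEnd_injective (by simp only [toEnd_mul, toEnd_one, one_mul])
    mul_one := fun f => toEnd_injective (by simp only [toEnd_mul, toEnd_one, mul_one]) }

/-- The affine Schur algebra is a `K`-algebra. -/
instance [NeZero n] : Algebra K (AffineSchurAlgebra K n r) :=
  Algebra.ofModule
    (fun x f g => toEnd_injective (by simp only [toEnd_mul, toEnd_smul, smul_mul_assoc]))
    (fun x f g => toEnd_injective (by simp only [toEnd_mul, toEnd_smul, mul_smul_comm]))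

theorem basisElt_mul_basisElt (a b : Orbit n r) :
    basisElt K a * basisElt K b = basisMul K a b :=
  toEnd_injective (by rw [toEnd_mul, toEnd_basisMul])

/-- The element `ξ_{i,i}` is an idempotent. -/
theorem isIdempotentElem_xi (K : Type*) [CommRing K] (n : ℕ) {r : ℕ} (i : Tuple r) :
    IsIdempotentElem (xi K n i i) := by
  classical
  change basisElt K _ * basisElt K _ = basisElt K _
  rw [basisElt_mul_basisElt]
  ext p q
  rw [coeff_basisMul, structureConst_orbit, coeff_basisElt]
  split_ifs with h
  · obtain rfl := diag_orbit h
    have : {s : Tuple r | orbit n i i = orbit n p s ∧ orbit n s p = orbit n i i} = {p} := by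
      ext s
      simp only [Set.mem_ofPred_eq, Set.mem_singleton_iff]
      exact ⟨fun hs => (diag_orbit hs.1).symm, fun hs => by subst hs; exact ⟨h, h.symm⟩⟩
    rw [this, Set.ncard_singleton, Nat.cast_one]
  · have : {s : Tuple r | orbit n i i = orbit n p s ∧ orbit n s q = orbit n i i} = ∅ := by
      ext s
      simp only [Set.mem_ofPred_eq, Set.mem_empty_iff_false, iff_false]
      rintro ⟨h1, h2⟩
      obtain rfl := diag_orbit h1
      exact h h2.symm
    rw [this, Set.ncard_empty, Nat.cast_zero]

/-- The centralizer algebra `S̃(i) = ξ_{i,i} S̃(n, r) ξ_{i,i}`, a ring with identity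
`ξ_{i,i}`. -/
abbrev Centralizer (K : Type*) [CommRing K] (n : ℕ) [NeZero n] {r : ℕ} (i : Tuple r) : Type _ :=
  (isIdempotentElem_xi K n i).Corner

end AffineSchur

end

/-! The algebra is module-finite over a central Noetherian subring, the image of the symmetric
Laurent polynomials.

Through `toEnd`, its elements are the matrices on `I(ℤ, r)` with finite columns that are constant on
diagonal orbits, that is, the endomorphisms of the free module commuting with the extended affine
Weyl group (`exists_toEnd_eq`). Laurent polynomials act on that module by shifts. A symmetric one
commutes with the whole group, so it comes from the algebra; it is central there because every
`toEnd f` commutes with shifts.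

An element is determined by its columns at `I(n, r)` (`baseColumns_injective`), so the algebra
embeds in finitely many copies of the free module. This module is finite over the Laurent ring,
which is finite over its `Σ_r`-invariants, and these are Noetherian by Artin–Tate. Corners are
submodules over the same central ring, and one-sided ideals are submodules too. -/

noncomputable section

/-! ### Noetherian modules over a central ring of scalars, and corners -/

/-- An algebra that is a Noetherian module over a commutative ring is left and right
Noetherian. -/
theorem isNoetherianRing_and_op_of_isNoetherian (A S : Type*) [CommRing A] [Ring S] [Algebra A S]
    [IsNoetherian A S] : IsNoetherianRing S ∧ IsNoetherianRing Sᵐᵒᵖ :=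
  -- Scalars act centrally, so `S` and its opposite are the same `A`-module.
  have : IsNoetherian A Sᵐᵒᵖ := isNoetherian_of_linearEquiv (MulOpposite.opLinearEquiv A)
  ⟨isNoetherian_of_tower A inferInstance, isNoetherian_of_tower A inferInstance⟩

namespace IsIdempotentElem

variable {S : Type*} [Ring S] {e : S} (idem : IsIdempotentElem e)

/-- The structure map of the corner ring `e S e` of an `A`-algebra `S`. -/
def cornerAlgebraMap (A : Type*) [CommRing A] [Algebra A S] : A →+* idem.Corner where
  toFun a := ⟨algebraMap A S a * e, (Subsemigroup.mem_corner_iff idem).2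
    ⟨by rw [← mul_assoc, ← Algebra.commutes, mul_assoc, idem.eq],
      by rw [mul_assoc, idem.eq]⟩⟩
  map_one' := Subtype.ext ((congrArg (· * e) (map_one (algebraMap A S))).trans (one_mul e))
  map_zero' := Subtype.ext ((congrArg (· * e) (map_zero (algebraMap A S))).trans (zero_mul e))
  map_mul' a b := Subtype.ext (by
    change algebraMap A S (a * b) * e = (algebraMap A S a * e) * (algebraMap A S b * e)
    rw [mul_assoc _ e, ← mul_assoc e, ← Algebra.commutes b e, mul_assoc _ e e, idem.eq, map_mul,
      mul_assoc])
  map_add' a b := Subtype.ext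
    ((congrArg (· * e) (map_add (algebraMap A S) a b)).trans (add_mul _ _ e))

/-- The corner is an `A`-submodule of `S`, and `a ↦ a e` maps `A` to its centre. -/
theorem isNoetherianRing_corner_and_op (A : Type*) [CommRing A] [Algebra A S] [IsNoetherian A S] :
    IsNoetherianRing idem.Corner ∧ IsNoetherianRing idem.Cornerᵐᵒᵖ := by
  have left (x : idem.Corner) : e * x.1 = x.1 := ((Subsemigroup.mem_corner_iff idem).1 x.2).1
  have right (x : idem.Corner) : x.1 * e = x.1 := ((Subsemigroup.mem_corner_iff idem).1 x.2).2
  have val_map (a : A) (x : idem.Corner) :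
      (idem.cornerAlgebraMap A a * x).1 = a • x.1 := by
    change algebraMap A S a * e * x.1 = _
    rw [mul_assoc, left, Algebra.smul_def]
  let : Algebra A idem.Corner := (idem.cornerAlgebraMap A).toAlgebra' fun a x => Subtype.ext (by
    rw [val_map]
    change _ = x.1 * (algebraMap A S a * e)
    rw [← mul_assoc, ← Algebra.commutes, mul_assoc, right, Algebra.smul_def])
  let f : idem.Corner →ₗ[A] S :=
    { toFun := fun x => x.1
      map_add' := fun _ _ => rfl
      map_smul' := val_map }
  have : IsNoetherian A idem.Corner := isNoetherian_of_injective f Subtype.val_injective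
  exact isNoetherianRing_and_op_of_isNoetherian A idem.Corner

end IsIdempotentElem

/-! ### Invariants of finite groups -/

/-- A finite-type commutative algebra over a Noetherian ring is finite over its ring of invariants
under a finite group, and this ring of invariants is Noetherian. -/
theorem FixedPoints.finite_and_isNoetherianRing_subalgebra (K R G : Type*) [CommRing K]
    [IsNoetherianRing K] [CommRing R] [Algebra K R] [Algebra.FiniteType K R] [Group G] [Finite G]
    [MulSemiringAction G R] [SMulCommClass G K R] :
    Module.Finite (FixedPoints.subalgebra K R G) R ∧
      IsNoetherianRing (FixedPoints.subalgebra K R G) := by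
  have : Algebra.IsInvariant (FixedPoints.subalgebra K R G) R G := ⟨fun x hx => ⟨⟨x, hx⟩, rfl⟩⟩
  -- Each `x` is a root of the monic polynomial `∏ (X - g • x)`, whose coefficients are invariant.
  have := Algebra.IsInvariant.isIntegral (FixedPoints.subalgebra K R G) R G
  have : Algebra.FiniteType (FixedPoints.subalgebra K R G) R :=
    .of_restrictScalars_finiteType K _ _
  have hfin : Module.Finite (FixedPoints.subalgebra K R G) R := Algebra.IsIntegral.finite
  -- Artin–Tate; the Hilbert basis theorem then gives Noetherianity.
  have hft : Algebra.FiniteType K (FixedPoints.subalgebra K R G) :=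
    ⟨fg_of_fg_of_fg K (FixedPoints.subalgebra K R G) R Algebra.FiniteType.out hfin.1
      Subtype.val_injective⟩
  exact ⟨hfin, Algebra.FiniteType.isNoetherianRing K _⟩

namespace AffineSchur

/-! ### Symmetric Laurent polynomials -/

section PlaceAction

/-- Place permutation on `ℤ^r` as an additive automorphism. -/
def placePerm {r : ℕ} (σ : Equiv.Perm (Fin r)) : (Fin r → ℤ) ≃+ (Fin r → ℤ) :=
  { Equiv.arrowCongr σ (Equiv.refl ℤ) with map_add' := fun _ _ => rfl }

/-- The inverse makes place permutation a left action. -/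
theorem placePerm_apply {r : ℕ} (σ : Equiv.Perm (Fin r)) (ε : Fin r → ℤ) (t : Fin r) :
    placePerm σ ε t = ε (σ⁻¹ t) := rfl

/-- The action of `Σ_r` on the ring of Laurent polynomials in `r` variables. -/
def laurentPerm (K : Type*) [CommRing K] (r : ℕ) :
    Equiv.Perm (Fin r) →*
      (AddMonoidAlgebra K (Fin r → ℤ) ≃ₐ[K] AddMonoidAlgebra K (Fin r → ℤ)) where
  toFun σ := AddMonoidAlgebra.domCongr K K (placePerm σ)
  map_one' := AlgEquiv.ext fun x => by
    induction x using AddMonoidAlgebra.induction_linear with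
    | zero => rw [map_zero, map_zero]
    | add x y hx hy => rw [map_add, map_add, hx, hy]
    | single ε x => exact AddMonoidAlgebra.domCongr_single ..
  map_mul' σ τ := AlgEquiv.ext fun x => by
    induction x using AddMonoidAlgebra.induction_linear with
    | zero => rw [map_zero, map_zero]
    | add x y hx hy => rw [map_add, map_add, hx, hy]
    | single ε x =>
      rw [AlgEquiv.mul_apply]
      simp only [AddMonoidAlgebra.domCongr_single]
      rfl

theorem laurentPerm_single {K : Type*} [CommRing K] {r : ℕ} (σ : Equiv.Perm (Fin r))
    (ε : Fin r → ℤ) (x : K) :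
    laurentPerm K r σ (AddMonoidAlgebra.single ε x) =
      AddMonoidAlgebra.single (placePerm σ ε) x :=
  AddMonoidAlgebra.domCongr_single ..

instance (K : Type*) [CommRing K] (r : ℕ) :
    MulSemiringAction (Equiv.Perm (Fin r)) (AddMonoidAlgebra K (Fin r → ℤ)) :=
  MulSemiringAction.compHom _ (laurentPerm K r)

theorem perm_smul_def {K : Type*} [CommRing K] {r : ℕ} (σ : Equiv.Perm (Fin r))
    (x : AddMonoidAlgebra K (Fin r → ℤ)) : σ • x = laurentPerm K r σ x := rfl

instance (K : Type*) [CommRing K] (r : ℕ) :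
    SMulCommClass (Equiv.Perm (Fin r)) K (AddMonoidAlgebra K (Fin r → ℤ)) :=
  ⟨fun σ x f => map_smul (laurentPerm K r σ) x f⟩

end PlaceAction

/-- The symmetric Laurent polynomials in `r` variables. -/
abbrev SymmLaurent (K : Type*) [CommRing K] (r : ℕ) :
    Subalgebra K (AddMonoidAlgebra K (Fin r → ℤ)) :=
  FixedPoints.subalgebra K (AddMonoidAlgebra K (Fin r → ℤ)) (Equiv.Perm (Fin r))

variable {K : Type*} [CommRing K] {n r : ℕ}

/-! ### Endomorphisms commuting with the extended affine Weyl group -/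

/-- The action of an element of the extended affine Weyl group on the free module on
`I(ℤ, r)`. -/
def actEnd (K : Type*) [CommRing K] (n : ℕ) {r : ℕ} (σ : Equiv.Perm (Fin r)) (ε : Fin r → ℤ) :
    Module.End K (Tuple r →₀ K) :=
  Finsupp.lmapDomain K K fun i => act n i σ ε

theorem actEnd_single (σ : Equiv.Perm (Fin r)) (ε : Fin r → ℤ) (q : Tuple r) (x : K) :
    actEnd K n σ ε (Finsupp.single q x) = Finsupp.single (act n q σ ε) x :=
  Finsupp.mapDomain_single

theorem actEnd_apply_act (σ : Equiv.Perm (Fin r)) (ε : Fin r → ℤ) (v : Tuple r →₀ K)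
    (p : Tuple r) : actEnd K n σ ε v (act n p σ ε) = v p :=
  Finsupp.mapDomain_apply (act_injective n σ ε) v p

/-- The matrix entries of `toEnd f` depend only on the diagonal orbit of their index. -/
theorem toEnd_mul_actEnd (f : AffineSchurAlgebra K n r) (σ : Equiv.Perm (Fin r))
    (ε : Fin r → ℤ) : toEnd f * actEnd K n σ ε = actEnd K n σ ε * toEnd f := by
  refine Finsupp.lhom_ext' fun q => LinearMap.ext_ring ?_
  ext p
  obtain ⟨p, rfl⟩ := act_surjective n σ ε p
  change toEnd f (actEnd K n σ ε (Finsupp.single q 1)) (act n p σ ε) =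
    actEnd K n σ ε (toEnd f (Finsupp.single q 1)) (act n p σ ε)
  rw [actEnd_single, actEnd_apply_act, toEnd_single, toEnd_single, orbit_act]

/-- The element of `I(n, r)` attached to a map `Fin r → Fin n`. -/
def baseTuple {n r : ℕ} (b : Fin r → Fin n) : Tuple r := fun t => (b t : ℤ) + 1

theorem exists_act_baseTuple [NeZero n] (q : Tuple r) :
    ∃ (b : Fin r → Fin n) (ε : Fin r → ℤ), act n (baseTuple b) 1 ε = q := by
  have hn : (0 : ℤ) < n := by exact_mod_cast NeZero.pos n
  -- Division with remainder, offset by one because the representatives are `1, …, n`.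
  refine ⟨fun t => ⟨((q t - 1) % n).toNat, ?_⟩, fun t => (q t - 1) / n, ?_⟩
  · have := Int.emod_lt_of_pos (q t - 1) hn
    have := Int.emod_nonneg (q t - 1) hn.ne'
    omega
  · funext t
    have h1 := Int.emod_nonneg (q t - 1) hn.ne'
    have h2 := Int.emod_add_mul_ediv (q t - 1) n
    simp only [act, baseTuple, Equiv.Perm.coe_one, id, Int.toNat_of_nonneg h1]
    linarith

theorem exists_orbit_baseTuple [NeZero n] (p q : Tuple r) :
    ∃ (b : Fin r → Fin n) (p' : Tuple r), orbit n p q = orbit n p' (baseTuple b) := by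
  obtain ⟨b, ε, rfl⟩ := exists_act_baseTuple (n := n) q
  obtain ⟨p', rfl⟩ := act_surjective n 1 ε p
  exact ⟨b, p', orbit_act n _ _ _ _⟩

/-- The affine Schur algebra contains every endomorphism commuting with the extended affine Weyl
group. -/
theorem exists_toEnd_eq [NeZero n] (φ : Module.End K (Tuple r →₀ K))
    (h : ∀ (σ : Equiv.Perm (Fin r)) (ε : Fin r → ℤ), φ * actEnd K n σ ε = actEnd K n σ ε * φ) :
    ∃ f : AffineSchurAlgebra K n r, toEnd f = φ := by
  have key (σ : Equiv.Perm (Fin r)) (ε : Fin r → ℤ) (p q : Tuple r) :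
      φ (Finsupp.single (act n q σ ε) 1) (act n p σ ε) = φ (Finsupp.single q 1) p := by
    rw [← actEnd_single, ← Module.End.mul_apply, h, Module.End.mul_apply, actEnd_apply_act]
  let g : Orbit n r → K := Quotient.lift (fun x => φ (Finsupp.single x.2 1) x.1) (by
    rintro ⟨p, q⟩ ⟨p', q'⟩ ⟨σ, ε, h1, h2⟩
    simp only at h1 h2
    subst h1 h2
    exact (key σ ε p q).symm)
  have hg : (Function.support g).Finite := by
    -- Every orbit meets one of the finitely many base columns, and each column has finite support.
    refine (Set.finite_iUnion fun b : Fin r → Fin n =>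
      (φ (Finsupp.single (baseTuple b) 1)).support.finite_toSet.image
        fun p => orbit n p (baseTuple b)).subset ?_
    intro c hc
    obtain ⟨⟨p, q⟩, rfl⟩ := Quotient.exists_rep c
    obtain ⟨b, p', hb⟩ := exists_orbit_baseTuple (n := n) p q
    change g (orbit n p q) ≠ 0 at hc
    change orbit n p q ∈ _
    rw [hb] at hc ⊢
    exact Set.mem_iUnion.2 ⟨b, p', Finsupp.mem_support_iff.2 hc, rfl⟩
  exact ⟨(Finsupp.ofSupportFinite g hg : Orbit n r →₀ K), toEnd_ext fun _ _ => rfl⟩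

/-- `toEnd` as an algebra homomorphism. -/
def toEndAlgHom (K : Type*) [CommRing K] (n r : ℕ) [NeZero n] :
    AffineSchurAlgebra K n r →ₐ[K] Module.End K (Tuple r →₀ K) :=
  AlgHom.ofLinearMap (toEndL K n r) toEnd_one toEnd_mul

/-- The group acts on the right, so composition reverses the order of the factors. -/
theorem actEnd_mul_actEnd (σ τ : Equiv.Perm (Fin r)) (ε η : Fin r → ℤ) :
    actEnd K n τ η * actEnd K n σ ε = actEnd K n (σ * τ) (ε ∘ τ + η) := by
  refine Finsupp.lhom_ext' fun q => LinearMap.ext_ring ?_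
  change actEnd K n τ η (actEnd K n σ ε (Finsupp.single q 1)) =
    actEnd K n (σ * τ) _ (Finsupp.single q 1)
  simp only [actEnd_single]
  congr 1
  funext t
  simp only [act, Equiv.Perm.mul_apply, Pi.add_apply, Function.comp_apply]
  ring

theorem actEnd_one_zero : actEnd K n (1 : Equiv.Perm (Fin r)) 0 = 1 := by
  refine Finsupp.lhom_ext' fun q => LinearMap.ext_ring ?_
  change actEnd K n 1 0 (Finsupp.single q 1) = Finsupp.single q 1
  rw [actEnd_single]
  congr 1
  funext t
  simp [act]

/-! ### The central action of symmetric Laurent polynomials -/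

/-- Laurent polynomials in `r` variables act on the free module on `I(ℤ, r)`, with monomials acting
by shifts. -/
def shiftHom (K : Type*) [CommRing K] (n r : ℕ) :
    AddMonoidAlgebra K (Fin r → ℤ) →ₐ[K] Module.End K (Tuple r →₀ K) :=
  AddMonoidAlgebra.lift K (Module.End K (Tuple r →₀ K)) (Fin r → ℤ)
    { toFun := fun ε => actEnd K n 1 ε.toAdd
      map_one' := actEnd_one_zero
      map_mul' := fun ε η => by
        rw [actEnd_mul_actEnd, toAdd_mul, add_comm ε.toAdd, mul_one]
        rfl }

theorem shiftHom_single (ε : Fin r → ℤ) (x : K) :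
    shiftHom K n r (AddMonoidAlgebra.single ε x) = x • actEnd K n 1 ε :=
  AddMonoidAlgebra.lift_single _ _ _

/-- Moving a shift past a place permutation permutes its exponents; hence symmetric elements commute
with the whole group. -/
theorem shiftHom_smul_mul_actEnd (x : AddMonoidAlgebra K (Fin r → ℤ)) (σ : Equiv.Perm (Fin r))
    (ε : Fin r → ℤ) :
    shiftHom K n r x * actEnd K n σ ε = actEnd K n σ ε * shiftHom K n r (σ • x) := by
  induction x using AddMonoidAlgebra.induction_linear with
  | zero => simp
  | add x y hx hy => simp only [map_add, smul_add, add_mul, mul_add, hx, hy]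
  | single η x =>
    rw [perm_smul_def, laurentPerm_single, shiftHom_single, shiftHom_single, smul_mul_assoc,
      mul_smul_comm, actEnd_mul_actEnd, actEnd_mul_actEnd, one_mul, mul_one]
    congr 2
    funext t
    simp [placePerm_apply, add_comm]

theorem toEnd_mul_shiftHom (f : AffineSchurAlgebra K n r) (x : AddMonoidAlgebra K (Fin r → ℤ)) :
    toEnd f * shiftHom K n r x = shiftHom K n r x * toEnd f := by
  induction x using AddMonoidAlgebra.induction_linear with
  | zero => simp
  | add x y hx hy => simp only [map_add, add_mul, mul_add, hx, hy]
  | single η x =>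
    rw [shiftHom_single, mul_smul_comm, smul_mul_assoc, toEnd_mul_actEnd]

theorem shiftHom_mem_range [NeZero n] (x : SymmLaurent K r) :
    shiftHom K n r x ∈ (toEndAlgHom K n r).range := by
  obtain ⟨f, hf⟩ := exists_toEnd_eq (n := n) (shiftHom K n r x) fun σ ε => by
    rw [shiftHom_smul_mul_actEnd, x.2 σ]
  exact ⟨f, hf⟩

/-- The central embedding of the symmetric Laurent polynomials into the affine Schur algebra. -/
def symmLaurentHom (K : Type*) [CommRing K] (n r : ℕ) [NeZero n] :
    SymmLaurent K r →ₐ[K] AffineSchurAlgebra K n r :=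
  (AlgEquiv.ofInjective (toEndAlgHom K n r) toEnd_injective).symm.toAlgHom.comp
    (((shiftHom K n r).comp (SymmLaurent K r).val).codRestrict _ shiftHom_mem_range)

theorem toEnd_symmLaurentHom [NeZero n] (x : SymmLaurent K r) :
    toEnd (symmLaurentHom K n r x) = shiftHom K n r x :=
  congrArg Subtype.val ((AlgEquiv.ofInjective (toEndAlgHom K n r) toEnd_injective).apply_symm_apply
    ⟨shiftHom K n r x, shiftHom_mem_range x⟩)

instance [NeZero n] : Algebra (SymmLaurent K r) (AffineSchurAlgebra K n r) :=
  (symmLaurentHom K n r).toRingHom.toAlgebra' fun x f => toEnd_injective (by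
    change toEnd (symmLaurentHom K n r x * f) = toEnd (f * symmLaurentHom K n r x)
    rw [toEnd_mul, toEnd_mul, toEnd_symmLaurentHom, toEnd_mul_shiftHom])

theorem toEnd_symmLaurent_smul [NeZero n] (x : SymmLaurent K r) (f : AffineSchurAlgebra K n r) :
    toEnd (x • f) = shiftHom K n r x * toEnd f := by
  rw [← toEnd_symmLaurentHom, ← toEnd_mul]
  rfl

/-! ### Finiteness over the symmetric Laurent polynomials -/

/-- The free module on `I(ℤ, r)`, as a module over the Laurent polynomials in `r` variables. -/
def ShiftModule (K : Type*) [CommRing K] (_n r : ℕ) : Type _ := Tuple r →₀ K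

instance : AddCommGroup (ShiftModule K n r) := inferInstanceAs (AddCommGroup (Tuple r →₀ K))

instance : Module (Module.End K (Tuple r →₀ K)) (ShiftModule K n r) :=
  inferInstanceAs (Module (Module.End K (Tuple r →₀ K)) (Tuple r →₀ K))

/-- The type records `n` because the monomial of exponent `ε` shifts by `n ε`. -/
instance : Module (AddMonoidAlgebra K (Fin r → ℤ)) (ShiftModule K n r) :=
  Module.compHom _ (shiftHom K n r).toRingHom

theorem shiftModule_smul_def (x : AddMonoidAlgebra K (Fin r → ℤ)) (v : Tuple r →₀ K) :
    (x • (show ShiftModule K n r from v)) = shiftHom K n r x v := rfl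

/-- The tuples in `I(n, r)` represent all orbits of the shifts, so their basis vectors generate. -/
instance [NeZero n] : Module.Finite (AddMonoidAlgebra K (Fin r → ℤ)) (ShiftModule K n r) := by
  refine ⟨Submodule.fg_def.2 ⟨Set.range fun b : Fin r → Fin n =>
    (show ShiftModule K n r from Finsupp.single (baseTuple b) (1 : K)), Set.finite_range _, ?_⟩⟩
  refine eq_top_iff.2 fun v _ => ?_
  refine Finsupp.induction_linear (motive := fun w : Tuple r →₀ K =>
    (show ShiftModule K n r from w) ∈ _) v (Submodule.zero_mem _)
    (fun _ _ h1 h2 => Submodule.add_mem _ h1 h2) fun q x => ?_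
  obtain ⟨b, ε, rfl⟩ := exists_act_baseTuple (n := n) q
  have h : (show ShiftModule K n r from Finsupp.single (act n (baseTuple b) 1 ε) x) =
      AddMonoidAlgebra.single ε x •
        (show ShiftModule K n r from Finsupp.single (baseTuple b) (1 : K)) := by
    rw [shiftModule_smul_def, shiftHom_single, LinearMap.smul_apply, actEnd_single,
      Finsupp.smul_single, smul_eq_mul, mul_one]
  rw [h]
  exact Submodule.smul_mem _ _ (Submodule.subset_span ⟨b, rfl⟩)

/-- The columns of an element of the affine Schur algebra at the elements of `I(n, r)`. -/
def baseColumns (K : Type*) [CommRing K] (n r : ℕ) [NeZero n] :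
    AffineSchurAlgebra K n r →ₗ[SymmLaurent K r] ((Fin r → Fin n) → ShiftModule K n r) where
  toFun f b := toEnd f (Finsupp.single (baseTuple b) 1)
  map_add' f g := funext fun b => by rw [toEnd_add]; rfl
  map_smul' x f := funext fun b => by rw [toEnd_symmLaurent_smul]; rfl

/-- Every diagonal orbit contains a pair whose second entry lies in `I(n, r)`. -/
theorem baseColumns_injective [NeZero n] : Function.Injective (baseColumns K n r) := by
  intro f g h
  ext p q
  obtain ⟨b, p', hb⟩ := exists_orbit_baseTuple (n := n) p q
  rw [hb, ← toEnd_single, ← toEnd_single]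
  exact DFunLike.congr_fun (F := Tuple r →₀ K) (congrFun h b) p'

/-- The affine Schur algebra over a Noetherian ring is a Noetherian module over the central
subalgebra of symmetric Laurent polynomials. -/
instance isNoetherian_symmLaurent [IsNoetherianRing K] [NeZero n] :
    IsNoetherian (SymmLaurent K r) (AffineSchurAlgebra K n r) := by
  -- This makes the Laurent ring an algebra of finite type over `K`.
  have : AddMonoid.FG (Fin r → ℤ) := inferInstance
  obtain ⟨hfin, hnoeth⟩ := FixedPoints.finite_and_isNoetherianRing_subalgebra K
    (AddMonoidAlgebra K (Fin r → ℤ)) (Equiv.Perm (Fin r))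
  have : Module.Finite (SymmLaurent K r) (ShiftModule K n r) :=
    Module.Finite.trans (AddMonoidAlgebra K (Fin r → ℤ)) _
  exact isNoetherian_of_injective (baseColumns K n r) baseColumns_injective

end AffineSchur

end

theorem theoremT (K : Type*) [Field K] [Infinite K] (n r : ℕ) [NeZero n] :
    (∀ i ∈ AffineSchur.tuples n r,
      IsNoetherianRing (AffineSchur.Centralizer K n i) ∧
      IsNoetherianRing (AffineSchur.Centralizer K n i)ᵐᵒᵖ) ∧
    (IsNoetherianRing (AffineSchurAlgebra K n r) ∧
      IsNoetherianRing (AffineSchurAlgebra K n r)ᵐᵒᵖ) :=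
  ⟨fun i _ => (AffineSchur.isIdempotentElem_xi K n i).isNoetherianRing_corner_and_op
      (AffineSchur.SymmLaurent K r),
    isNoetherianRing_and_op_of_isNoetherian (AffineSchur.SymmLaurent K r) _⟩
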